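/- A right loop is a set $S$ with a binary operation $\circ$ and a two-sided identity $1$ such that for all $a,b\in S$ the equation $X\circ a=b$ has a unique solution $X\in S$. A right subloop of $S$ is a non-empty subset that is a right loop under the induced operation. A congruence on $S$ is an equivalence relation on $S$ that is a right subloop of $S\times S$. An invariant right subloop $T$ of $S$ is the class of $1$ under a (necessarily unique) congruence $R$, and $S/T=S/R$ denotes the quotient right loop. Let $S^{(0)}=S$, let $S^{(1)}$ be the smallest invariant right subloop of $S$ whose quotient $S/S^{(1)}$ is an abelian group, and let $S^{(n+1)}=(S^{(n)})^{(1)}$, computed in the right loop $S^{(n)}$. The right loop $S$ is solvable if $S^{(n)}=\{1\}$ for some $n\in\mathbb N$. For congruences $\beta,\gamma$ on $S$, a congruence $C$ on the right loop $\beta\subseteq S\times S$ is a centering congruence by means of which $\gamma$ centralizes $\beta$ if, for all pairs occurring below that lie in $\beta$: (i) $(x,y)\,C\,(u,v)$ implies $x\,\gamma\,u$; (ii) for every $(x,y)\in\beta$, $(u,v)\mapsto u$ is a bijection from the $C$-class of $(x,y)$ onto the $\gamma$-class of $x$; (iii) $(x,x)\,C\,(y,y)$ for all $(x,y)\in\gamma$;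 (iv) $(x,y)\,C\,(u,v)$ implies $(y,x)\,C\,(v,u)$; (v) $(x,y)\,C\,(u,v)$ and $(y,z)\,C\,(v,w)$ imply $(x,z)\,C\,(u,w)$. A congruence is central if it is centralized by $S\times S$ (by means of some $C$). There is a greatest central congruence $\zeta(S)$; the center $\mathcal Z(S)$ is the class of $1$ under $\zeta(S)$. Let $\mathcal Z_0=\{1\}$ and let $\mathcal Z_{i+1}\supseteq\mathcal Z_i$ be the invariant right subloop with $\mathcal Z_{i+1}/\mathcal Z_i=\mathcal Z(S/\mathcal Z_i)$. The right loop $S$ is nilpotent if $\mathcal Z_n=S$ for some $n\in\mathbb N$. Lemma. Every nilpotent right loop is solvable. -/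

import Mathlib

universe u v

/-- A right loop: a set with a binary operation, a two-sided identity `1`, and a unique solution
`X` of `X * a = b` for all `a`, `b`. -/
class RightLoop (S : Type u) extends MulOneClass S where
  existsUnique_mul_eq : ∀ a b : S, ∃! x : S, x * a = b

namespace RightLoop

variable {S : Type u} [RightLoop S]

/-- Right division: `rdiv b a` is the unique solution `X` of `X * a = b`. -/
noncomputable def rdiv (b a : S) : S := (existsUnique_mul_eq a b).choose

theorem rdiv_mul (b a : S) : rdiv b a * a = b := (existsUnique_mul_eq a b).choose_spec.1

theorem eq_rdiv {x a b : S} (h : x * a = b) : x = rdiv b a :=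
  (existsUnique_mul_eq a b).unique h (rdiv_mul b a)

theorem mul_right_cancel' {x y a : S} (h : x * a = y * a) : x = y :=
  (existsUnique_mul_eq a (y * a)).unique h rfl

/-- The product of two right loops. -/
instance instProd {S' : Type v} [RightLoop S'] : RightLoop (S × S') where
  existsUnique_mul_eq a b := by
    refine ⟨(rdiv b.1 a.1, rdiv b.2 a.2), Prod.ext (rdiv_mul _ _) (rdiv_mul _ _), ?_⟩
    rintro ⟨x, y⟩ h
    exact Prod.ext (eq_rdiv (congrArg Prod.fst h)) (eq_rdiv (congrArg Prod.snd h))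

theorem rdiv_prod {S' : Type v} [RightLoop S'] (b a : S × S') :
    rdiv b a = (rdiv b.1 a.1, rdiv b.2 a.2) :=
  (eq_rdiv (Prod.ext (rdiv_mul b.1 a.1) (rdiv_mul b.2 a.2))).symm

end RightLoop

open RightLoop in
/-- A right subloop: a subset which is a right loop for the induced operation, that is, which
contains `1` and is closed under multiplication and right division. -/
structure RightSubloop (S : Type u) [RightLoop S] where
  carrier : Set S
  one_mem' : (1 : S) ∈ carrier
  mul_mem' : ∀ {a b : S}, a ∈ carrier → b ∈ carrier → a * b ∈ carrier
  rdiv_mem' : ∀ {a b : S}, a ∈ carrier → b ∈ carrier → rdiv a b ∈ carrier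

namespace RightSubloop

open RightLoop

variable {S : Type u} [RightLoop S]

instance : SetLike (RightSubloop S) S where
  coe := carrier
  coe_injective := by
    rintro ⟨A, _, _, _⟩ ⟨B, _, _, _⟩ h
    congr

/-- Right subloops are ordered by inclusion. -/
instance : PartialOrder (RightSubloop S) := PartialOrder.ofSetLike (RightSubloop S) S

/-- A right subloop is a right loop for the induced operation. -/
instance (T : RightSubloop S) : RightLoop T where
  one := ⟨1, T.one_mem'⟩
  mul a b := ⟨a.1 * b.1, T.mul_mem' a.2 b.2⟩
  one_mul a := Subtype.ext (one_mul a.1)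
  mul_one a := Subtype.ext (mul_one a.1)
  existsUnique_mul_eq a b :=
    ⟨⟨rdiv b.1 a.1, T.rdiv_mem' b.2 a.2⟩, Subtype.ext (rdiv_mul b.1 a.1),
      fun _ h => Subtype.ext (eq_rdiv (congrArg Subtype.val h))⟩

theorem coe_one (T : RightSubloop S) : ((1 : T) : S) = 1 := rfl

theorem coe_mul (T : RightSubloop S) (a b : T) : ((a * b : T) : S) = a * b := rfl

theorem coe_rdiv (T : RightSubloop S) (a b : T) : ((rdiv a b : T) : S) = rdiv (a : S) (b : S) :=
  eq_rdiv (congrArg Subtype.val (rdiv_mul a b))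

/-- The whole right loop, as a right subloop. -/
def whole (S : Type u) [RightLoop S] : RightSubloop S where
  carrier := Set.univ
  one_mem' := trivial
  mul_mem' _ _ := trivial
  rdiv_mem' _ _ := trivial

/-- A right subloop of a right subloop `T` of `S`, viewed as a right subloop of `S`. -/
def ofSub {T : RightSubloop S} (U : RightSubloop T) : RightSubloop S where
  carrier := (fun t : T => (t : S)) '' U.carrier
  one_mem' := ⟨1, U.one_mem', rfl⟩
  mul_mem' := by
    rintro _ _ ⟨a, ha, rfl⟩ ⟨b, hb, rfl⟩
    exact ⟨a * b, U.mul_mem' ha hb, rfl⟩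
  rdiv_mem' := by
    rintro _ _ ⟨a, ha, rfl⟩ ⟨b, hb, rfl⟩
    exact ⟨rdiv a b, U.rdiv_mem' ha hb, coe_rdiv T a b⟩

end RightSubloop

open RightLoop in
/-- A congruence on a right loop `S`: an equivalence relation which is a right subloop of `S × S`
(`RightLoopCon.graph` below), that is, which is compatible with multiplication and with right
division. -/
structure RightLoopCon (S : Type u) [RightLoop S] extends Con S where
  rdiv' : ∀ {a b c d : S}, r a b → r c d → r (rdiv a c) (rdiv b d)

namespace RightLoopCon

open RightLoop

variable {S : Type u} [RightLoop S]

/-- `R.Rel x y` means that the pair `(x, y)` belongs to the congruence `R`. -/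
def Rel (R : RightLoopCon S) (x y : S) : Prop := R.toCon x y

/-- A congruence as a right subloop of `S × S`. -/
def graph (R : RightLoopCon S) : RightSubloop (S × S) where
  carrier := {p | R.Rel p.1 p.2}
  one_mem' := R.toCon.refl 1
  mul_mem' ha hb := R.toCon.mul ha hb
  rdiv_mem' {a b} ha hb := by
    rw [rdiv_prod]
    exact R.rdiv' ha hb

/-- The invariant right subloop of a congruence: the equivalence class of `1`. -/
def oneClass (R : RightLoopCon S) : RightSubloop S where
  carrier := {x | R.Rel x 1}
  one_mem' := R.toCon.refl 1
  mul_mem' {a b} ha hb := by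
    have h := R.toCon.mul ha hb
    rwa [mul_one] at h
  rdiv_mem' {a b} ha hb := by
    have h : R.Rel (rdiv a b) (rdiv 1 1) := R.rdiv' ha hb
    rwa [← eq_rdiv (mul_one (1 : S))] at h

/-- The quotient of `S` by a congruence. -/
def Quot (R : RightLoopCon S) : Type u := R.toCon.Quotient

/-- The class of an element in the quotient. -/
def cls (R : RightLoopCon S) (x : S) : R.Quot := (x : R.toCon.Quotient)

theorem cls_eq_cls (R : RightLoopCon S) {x y : S} : R.cls x = R.cls y ↔ R.Rel x y := R.toCon.eq

theorem cls_surjective (R : RightLoopCon S) : Function.Surjective R.cls := Quotient.mk''_surjective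

/-- The quotient is a right loop for the operation induced on the classes. -/
instance (R : RightLoopCon S) : RightLoop R.Quot where
  toMulOneClass := inferInstanceAs (MulOneClass R.toCon.Quotient)
  existsUnique_mul_eq a b := by
    obtain ⟨a, rfl⟩ := R.cls_surjective a
    obtain ⟨b, rfl⟩ := R.cls_surjective b
    refine ⟨R.cls (rdiv b a), congrArg R.cls (rdiv_mul b a), fun x h => ?_⟩
    obtain ⟨x, rfl⟩ := R.cls_surjective x
    have h1 : R.Rel (x * a) b := R.cls_eq_cls.1 h
    have h2 : R.Rel (rdiv (x * a) a) (rdiv b a) := R.rdiv' h1 (R.toCon.refl a)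
    rw [← eq_rdiv (rfl : x * a = x * a)] at h2
    exact R.cls_eq_cls.2 h2

theorem cls_one (R : RightLoopCon S) : R.cls 1 = 1 := rfl

theorem cls_mul (R : RightLoopCon S) (x y : S) : R.cls (x * y) = R.cls x * R.cls y := rfl

theorem cls_rdiv (R : RightLoopCon S) (x y : S) : R.cls (rdiv x y) = rdiv (R.cls x) (R.cls y) :=
  eq_rdiv (congrArg R.cls (rdiv_mul x y))

theorem toCon_injective : Function.Injective (toCon : RightLoopCon S → Con S) := by
  rintro ⟨A, _⟩ ⟨B, _⟩ h
  congr

/-- Congruences are ordered by inclusion. -/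
instance : PartialOrder (RightLoopCon S) := PartialOrder.lift toCon toCon_injective

theorem le_iff {A B : RightLoopCon S} : A ≤ B ↔ ∀ x y, A.Rel x y → B.Rel x y := Iff.rfl

/-- The intersection of a set of congruences. -/
instance : InfSet (RightLoopCon S) where
  sInf 𝒜 :=
    { r := fun x y => ∀ R ∈ 𝒜, R.Rel x y
      iseqv := ⟨fun x R _ => R.toCon.refl x, fun h R hR => R.toCon.symm (h R hR),
        fun h k R hR => R.toCon.trans (h R hR) (k R hR)⟩
      mul' := fun h k R hR => R.toCon.mul (h R hR) (k R hR)
      rdiv' := fun h k R hR => R.rdiv' (h R hR) (k R hR) }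

theorem rel_sInf {𝒜 : Set (RightLoopCon S)} {x y : S} :
    (sInf 𝒜).Rel x y ↔ ∀ R ∈ 𝒜, R.Rel x y := Iff.rfl

/-- The join of a set of congruences: the smallest congruence containing all of them. -/
instance : SupSet (RightLoopCon S) where
  sSup 𝒜 := sInf (upperBounds 𝒜)

/-- The equality relation. -/
instance : Bot (RightLoopCon S) where
  bot :=
    { r := fun x y => x = y
      iseqv := eq_equivalence
      mul' := by
        rintro _ _ _ _ rfl rfl
        rfl
      rdiv' := by
        rintro _ _ _ _ rfl rfl
        rfl }

/-- The full relation `S × S`. -/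
instance : Top (RightLoopCon S) where
  top :=
    { r := fun _ _ => True
      iseqv := ⟨fun _ => trivial, fun _ => trivial, fun _ _ => trivial⟩
      mul' := fun _ _ => trivial
      rdiv' := fun _ _ => trivial }

/-- The pullback to `S` of a congruence on the quotient `S / R`. -/
def pullback (R : RightLoopCon S) (Q : RightLoopCon R.Quot) : RightLoopCon S where
  r x y := Q.Rel (R.cls x) (R.cls y)
  iseqv := ⟨fun x => Q.toCon.refl _, fun h => Q.toCon.symm h, fun h k => Q.toCon.trans h k⟩
  mul' h k := Q.toCon.mul h k
  rdiv' {a b c d} h k := by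
    show Q.Rel (R.cls (rdiv a c)) (R.cls (rdiv b d))
    rw [cls_rdiv, cls_rdiv]
    exact Q.rdiv' h k

end RightLoopCon

namespace RightLoop

/-! ### Solvable right loops -/

/-- The operation of the right loop `S` is that of an abelian group. -/
def IsAbelianGroup (S : Type u) [L : RightLoop S] : Prop :=
  ∃ G : CommGroup S, ∀ x y : S, G.mul x y = L.mul x y

theorem isAbelianGroup_iff {S : Type u} [RightLoop S] :
    IsAbelianGroup S ↔ (∀ x y z : S, x * y * z = x * (y * z)) ∧ ∀ x y : S, x * y = y * x := by
  constructor
  · rintro ⟨G, h⟩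
    have h' : ∀ x y : S, x * y = G.mul x y := fun x y => (h x y).symm
    refine ⟨fun x y z => ?_, fun x y => ?_⟩
    · simp only [h']
      exact G.mul_assoc x y z
    · simp only [h']
      exact G.mul_comm x y
  · rintro ⟨ha, hc⟩
    exact ⟨{ (inferInstance : MulOneClass S) with
      mul_assoc := ha
      mul_comm := hc
      inv := fun x => rdiv 1 x
      inv_mul_cancel := fun x => rdiv_mul 1 x }, fun _ _ => rfl⟩

/-- The derived subloop `S⁽¹⁾`: the smallest invariant right subloop of `S` whose quotient is an
abelian group (see `isLeast_derived`). -/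
def derived (S : Type u) [RightLoop S] : RightSubloop S :=
  (sInf {R : RightLoopCon S | IsAbelianGroup R.Quot}).oneClass

theorem isLeast_derived (S : Type u) [RightLoop S] :
    IsLeast {T : RightSubloop S | ∃ R : RightLoopCon S, R.oneClass = T ∧ IsAbelianGroup R.Quot}
      (derived S) := by
  refine ⟨⟨_, rfl, ?_⟩, ?_⟩
  · set I := sInf {R : RightLoopCon S | IsAbelianGroup R.Quot}
    refine isAbelianGroup_iff.2 ⟨fun x y z => ?_, fun x y => ?_⟩
    · obtain ⟨x, rfl⟩ := I.cls_surjective x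
      obtain ⟨y, rfl⟩ := I.cls_surjective y
      obtain ⟨z, rfl⟩ := I.cls_surjective z
      exact I.cls_eq_cls.2 fun R hR =>
        R.cls_eq_cls.1 ((isAbelianGroup_iff.1 hR).1 (R.cls x) (R.cls y) (R.cls z))
    · obtain ⟨x, rfl⟩ := I.cls_surjective x
      obtain ⟨y, rfl⟩ := I.cls_surjective y
      exact I.cls_eq_cls.2 fun R hR =>
        R.cls_eq_cls.1 ((isAbelianGroup_iff.1 hR).2 (R.cls x) (R.cls y))
  · rintro _ ⟨R, rfl, hR⟩ x hx
    exact hx R hR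

/-- The derived series `S⁽⁰⁾ = S`, `S⁽ⁿ⁺¹⁾ = (S⁽ⁿ⁾)⁽¹⁾`. -/
def derivedSeries (S : Type u) [RightLoop S] : ℕ → RightSubloop S
  | 0 => RightSubloop.whole S
  | n + 1 => RightSubloop.ofSub (derived (derivedSeries S n))

/-- `S` is solvable if `S⁽ⁿ⁾ = {1}` for some `n`. -/
def IsSolvable (S : Type u) [RightLoop S] : Prop :=
  ∃ n : ℕ, (derivedSeries S n : Set S) = {1}

/-! ### Nilpotent right loops -/

/-- `γ` centralizes `β` by means of the centering congruence `C`, which is a congruence on the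
right loop `β ⊆ S × S`. -/
structure Centralizes {S : Type u} [RightLoop S] (γ β : RightLoopCon S)
    (C : RightLoopCon β.graph) : Prop where
  rel_fst : ∀ p q : β.graph, C.Rel p q → γ.Rel p.1.1 q.1.1
  bijOn_fst : ∀ p : β.graph,
    Set.BijOn (fun q : β.graph => q.1.1) {q | C.Rel p q} {u | γ.Rel p.1.1 u}
  diag : ∀ x y : S, γ.Rel x y → C.Rel ⟨(x, x), β.toCon.refl x⟩ ⟨(y, y), β.toCon.refl y⟩
  swap : ∀ p q : β.graph, C.Rel p q →
    C.Rel ⟨(p.1.2, p.1.1), β.toCon.symm p.2⟩ ⟨(q.1.2, q.1.1), β.toCon.symm q.2⟩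
  comp : ∀ (x y z u v w : S) (hxy : β.Rel x y) (hyz : β.Rel y z) (huv : β.Rel u v)
    (hvw : β.Rel v w), C.Rel ⟨(x, y), hxy⟩ ⟨(u, v), huv⟩ → C.Rel ⟨(y, z), hyz⟩ ⟨(v, w), hvw⟩ →
    C.Rel ⟨(x, z), β.toCon.trans hxy hyz⟩ ⟨(u, w), β.toCon.trans huv hvw⟩

/-- A central congruence: one that is centralized by `S × S`. -/
def IsCentral {S : Type u} [RightLoop S] (α : RightLoopCon S) : Prop :=
  ∃ C : RightLoopCon α.graph, Centralizes ⊤ α C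

/-- The center congruence of `S`: the join of all central congruences. It is itself central, hence
the unique maximal central congruence (see `isGreatest_centerCon`). -/
def centerCon (S : Type u) [RightLoop S] : RightLoopCon S :=
  sSup {α : RightLoopCon S | IsCentral α}

/-- The center of `S`: the class of `1` for the center congruence. -/
def center (S : Type u) [RightLoop S] : RightSubloop S := (centerCon S).oneClass

/-- The congruences belonging to the upper central series: equality for `0`, and then
the pullback to `S` of the center congruence of the quotient by the previous one. -/
def upperCentralCon (S : Type u) [RightLoop S] : ℕ → RightLoopCon S
  | 0 => ⊥
  | i + 1 => (upperCentralCon S i).pullback (centerCon (upperCentralCon S i).Quot)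

/-- The upper central series `Z₀ = {1}`, `Zᵢ₊₁ / Zᵢ = Z(S / Zᵢ)`
(see `mem_upperCentralSeries_zero` and `mem_upperCentralSeries_succ`). -/
def upperCentralSeries (S : Type u) [RightLoop S] (i : ℕ) : RightSubloop S :=
  (upperCentralCon S i).oneClass

theorem mem_upperCentralSeries_zero {S : Type u} [RightLoop S] (x : S) :
    x ∈ upperCentralSeries S 0 ↔ x = 1 := Iff.rfl

theorem mem_upperCentralSeries_succ {S : Type u} [RightLoop S] (i : ℕ) (x : S) :
    x ∈ upperCentralSeries S (i + 1) ↔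
      (upperCentralCon S i).cls x ∈ center (upperCentralCon S i).Quot := Iff.rfl

/-- `S` is nilpotent if `Zₙ = S` for some `n`. -/
def IsNilpotent (S : Type u) [RightLoop S] : Prop :=
  ∃ n : ℕ, (upperCentralSeries S n : Set S) = Set.univ

/-! ### Existence of the greatest central congruence -/

/-- Elements commuting and associating with all elements. -/
structure IsCentralElement {S : Type u} [RightLoop S] (z : S) : Prop where
  comm : ∀ y : S, z * y = y * z
  assoc : ∀ x y : S, z * x * y = z * (x * y)
  left_comm : ∀ x y : S, x * (z * y) = z * (x * y)

section

variable {S : Type u} [RightLoop S]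

theorem IsCentral.isCentralElement {α : RightLoopCon S} (hα : IsCentral α) {z : S}
    (hz : α.Rel z 1) : IsCentralElement z := by
  obtain ⟨C, hC⟩ := hα
  have h1 : α.Rel 1 z := α.toCon.symm hz
  let p : α.graph := ⟨(1, z), h1⟩
  let d : S → α.graph := fun x => ⟨(x, x), α.toCon.refl x⟩
  have hd : ∀ x, C.Rel (d 1) (d x) := fun x => hC.diag 1 x trivial
  have huniq : ∀ q q' : α.graph, C.Rel p q → C.Rel p q' → q.1.1 = q'.1.1 → q.1.2 = q'.1.2 := by
    intro q q' h h' e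
    have := (hC.bijOn_fst p).injOn h h' e
    rw [this]
  have hr : ∀ q x, C.Rel p q → C.Rel p (q * d x) := by
    intro q x h
    have h2 := C.toCon.mul h (hd x)
    have e : p * d 1 = p := mul_one p
    rwa [e] at h2
  have hl : ∀ q x, C.Rel p q → C.Rel p (d x * q) := by
    intro q x h
    have h2 := C.toCon.mul (hd x) h
    have e : d 1 * p = p := one_mul p
    rwa [e] at h2
  have hp : C.Rel p p := C.toCon.refl p
  refine ⟨fun y => ?_, fun x y => ?_, fun x y => ?_⟩
  · refine huniq _ _ (hr p y hp) (hl p y hp) ?_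
    show 1 * y = y * 1
    rw [one_mul, mul_one]
  · refine huniq _ _ (hr _ y (hr p x hp)) (hr p (x * y) hp) ?_
    show 1 * x * y = 1 * (x * y)
    rw [one_mul, one_mul]
  · refine huniq _ _ (hl _ x (hr p y hp)) (hr p (x * y) hp) ?_
    show x * (1 * y) = 1 * (x * y)
    rw [one_mul, one_mul]

namespace IsCentralElement

theorem one : IsCentralElement (1 : S) :=
  ⟨fun y => by simp, fun x y => by simp, fun x y => by simp⟩

theorem mul {z w : S} (hz : IsCentralElement z) (hw : IsCentralElement w) :
    IsCentralElement (z * w) := by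
  refine ⟨fun y => ?_, fun x y => ?_, fun x y => ?_⟩
  · rw [hz.assoc, hz.left_comm, hw.comm]
  · rw [hz.assoc, hz.assoc, hz.assoc, hw.assoc]
  · rw [hz.assoc, hz.assoc, hz.left_comm, hw.left_comm]

theorem left_cancel {z x y : S} (hz : IsCentralElement z) (h : z * x = z * y) : x = y := by
  rw [hz.comm, hz.comm] at h
  exact mul_right_cancel' h

theorem mul_inv {z : S} (hz : IsCentralElement z) (y : S) : z * (rdiv 1 z * y) = y := by
  rw [← hz.assoc, hz.comm, rdiv_mul, one_mul]

theorem inv {z : S} (hz : IsCentralElement z) : IsCentralElement (rdiv 1 z) := by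
  have hz1 : z * rdiv 1 z = 1 := by rw [hz.comm, rdiv_mul]
  refine ⟨fun y => hz.left_cancel ?_, fun x y => hz.left_cancel ?_, fun x y => hz.left_cancel ?_⟩
  · rw [hz.mul_inv, ← hz.left_comm, hz1, mul_one]
  · rw [hz.mul_inv, ← hz.assoc, hz.mul_inv]
  · rw [hz.mul_inv, ← hz.left_comm, hz.mul_inv]

theorem inv_mul {z : S} (hz : IsCentralElement z) (y : S) : rdiv 1 z * (z * y) = y := by
  rw [← hz.inv.assoc, rdiv_mul, one_mul]

theorem mul_mul {z w : S} (hz : IsCentralElement z) (hw : IsCentralElement w) (x y : S) :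
    z * x * (w * y) = z * w * (x * y) := by
  rw [hz.assoc, hz.assoc, hw.left_comm]

theorem rdiv_mul_mul {z w : S} (hz : IsCentralElement z) (hw : IsCentralElement w) (x y : S) :
    rdiv (z * x) (w * y) = z * rdiv 1 w * rdiv x y := by
  refine (eq_rdiv ?_).symm
  rw [(hz.mul hw.inv).mul_mul hw, hz.assoc, rdiv_mul, mul_one, rdiv_mul]

end IsCentralElement

/-- The congruence of the central elements. -/
def centralElementCon (S : Type u) [RightLoop S] : RightLoopCon S where
  r x y := ∃ z, IsCentralElement z ∧ y = z * x
  iseqv := by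
    refine ⟨fun x => ⟨1, .one, (one_mul x).symm⟩, ?_, ?_⟩
    · rintro x _ ⟨z, hz, rfl⟩
      exact ⟨_, hz.inv, (hz.inv_mul x).symm⟩
    · rintro x _ _ ⟨z, hz, rfl⟩ ⟨w, hw, rfl⟩
      exact ⟨_, hw.mul hz, (hw.assoc z x).symm⟩
  mul' := by
    rintro x _ x' _ ⟨z, hz, rfl⟩ ⟨w, hw, rfl⟩
    exact ⟨_, hz.mul hw, hz.mul_mul hw x x'⟩
  rdiv' := by
    rintro x _ x' _ ⟨z, hz, rfl⟩ ⟨w, hw, rfl⟩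
    exact ⟨_, hz.mul hw.inv, hz.rdiv_mul_mul hw x x'⟩

/-- The centering congruence: `(x, z * x)` is related to `(u, z * u)`. -/
def centralElementCentering (S : Type u) [RightLoop S] :
    RightLoopCon (centralElementCon S).graph where
  r p q := ∃ z, IsCentralElement z ∧ p.1.2 = z * p.1.1 ∧ q.1.2 = z * q.1.1
  iseqv := by
    refine ⟨fun p => ?_, ?_, ?_⟩
    · obtain ⟨z, hz, h⟩ := p.2
      exact ⟨z, hz, h, h⟩
    · rintro p q ⟨z, hz, h, k⟩
      exact ⟨z, hz, k, h⟩
    · rintro p q r ⟨z, hz, h, k⟩ ⟨w, hw, h', k'⟩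
      have e : z = w := mul_right_cancel' (k.symm.trans h')
      subst e
      exact ⟨z, hz, h, k'⟩
  mul' := by
    rintro p q p' q' ⟨z, hz, h, k⟩ ⟨w, hw, h', k'⟩
    refine ⟨z * w, hz.mul hw, ?_, ?_⟩
    · show p.1.2 * p'.1.2 = z * w * (p.1.1 * p'.1.1)
      rw [h, h', hz.mul_mul hw]
    · show q.1.2 * q'.1.2 = z * w * (q.1.1 * q'.1.1)
      rw [k, k', hz.mul_mul hw]
  rdiv' := by
    rintro p q p' q' ⟨z, hz, h, k⟩ ⟨w, hw, h', k'⟩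
    refine ⟨z * rdiv 1 w, hz.mul hw.inv, ?_, ?_⟩
    · rw [RightSubloop.coe_rdiv, rdiv_prod]
      dsimp only
      rw [h, h', hz.rdiv_mul_mul hw]
    · rw [RightSubloop.coe_rdiv, rdiv_prod]
      dsimp only
      rw [k, k', hz.rdiv_mul_mul hw]

theorem isCentral_centralElementCon : IsCentral (centralElementCon S) := by
  refine ⟨centralElementCentering S, fun _ _ _ => trivial, fun p => ⟨?_, ?_, ?_⟩, ?_, ?_, ?_⟩
  · exact fun _ _ => trivial
  · rintro q ⟨z, hz, h, k⟩ q' ⟨w, hw, h', k'⟩ e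
    have ezw : z = w := mul_right_cancel' (h.symm.trans h')
    subst ezw
    have e' : q.1.1 = q'.1.1 := e
    exact Subtype.ext (Prod.ext e' (by rw [k, k', e']))
  · rintro u -
    obtain ⟨z, hz, h⟩ := p.2
    exact ⟨⟨(u, z * u), z, hz, rfl⟩, ⟨z, hz, h, rfl⟩, rfl⟩
  · exact fun x y _ => ⟨1, .one, (one_mul x).symm, (one_mul y).symm⟩
  · rintro p q ⟨z, hz, h, k⟩
    refine ⟨_, hz.inv, ?_, ?_⟩
    · show p.1.1 = _ * p.1.2
      rw [h, hz.inv_mul]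
    · show q.1.1 = _ * q.1.2
      rw [k, hz.inv_mul]
  · rintro x y t u v w hxy hyt huv hvw ⟨z, hz, h, k⟩ ⟨z', hz', h', k'⟩
    dsimp only at h k h' k'
    refine ⟨z' * z, hz'.mul hz, ?_, ?_⟩
    · show t = z' * z * x
      rw [h', h, hz'.assoc]
    · show w = z' * z * u
      rw [k', k, hz'.assoc]

theorem IsCentral.le_centralElementCon {α : RightLoopCon S} (hα : IsCentral α) :
    α ≤ centralElementCon S := by
  refine RightLoopCon.le_iff.2 fun x y h => ?_
  have h2 : α.Rel (rdiv y x) (rdiv x x) := α.rdiv' (α.toCon.symm h) (α.toCon.refl x)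
  rw [← eq_rdiv (one_mul x)] at h2
  exact ⟨rdiv y x, hα.isCentralElement h2, (rdiv_mul y x).symm⟩

end

theorem isGreatest_centerCon (S : Type u) [RightLoop S] :
    IsGreatest {α : RightLoopCon S | IsCentral α} (centerCon S) := by
  have e : centerCon S = centralElementCon S := by
    apply le_antisymm
    · exact RightLoopCon.le_iff.2 fun x y h => h _ fun α hα => hα.le_centralElementCon
    · exact RightLoopCon.le_iff.2 fun x y h R hR =>
        RightLoopCon.le_iff.1 (hR isCentral_centralElementCon) x y h
  rw [e]
  exact ⟨isCentral_centralElementCon, fun α hα => hα.le_centralElementCon⟩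

end RightLoop

namespace RightLoopCon

open RightLoop

/-! The derived series descends at least as fast as the upper central series: if `Zₙ = S`, then
`S⁽ᵏ⁾ ⊆ Zₙ₋ₖ` for all `k ≤ n`, and `k = n` gives `S⁽ⁿ⁾ ⊆ Z₀ = {1}`.

For the inductive step let `T` be a right subloop contained in `Zᵢ₊₁`. The image of `T` in `S / Zᵢ`
lies in the center, and elements of the center commute and associate with everything
(`IsCentral.isCentralElement`). So the congruence of `Zᵢ`, restricted to `T`, has an abelian group
as quotient. Its class of `1` is `T ∩ Zᵢ`, which therefore contains `T⁽¹⁾`. Centering congruences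
enter only through this elementwise description of the center. -/

/-- The restriction of a congruence on `S` to a right subloop of `S`. -/
def restrict {S : Type u} [RightLoop S] (R : RightLoopCon S) (T : RightSubloop S) :
    RightLoopCon T where
  r x y := R.Rel x y
  iseqv := ⟨fun x => R.toCon.refl x, fun h => R.toCon.symm h, fun h k => R.toCon.trans h k⟩
  mul' h k := R.toCon.mul h k
  rdiv' {a b c d} h k := by
    rw [RightSubloop.coe_rdiv, RightSubloop.coe_rdiv]
    exact R.rdiv' h k

/-- The quotient of `T` embeds in `S / R` with image made of central elements, so it inherits
associativity and commutativity. By `isAbelianGroup_iff` these two laws suffice, right division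
supplying the inverses. -/
theorem isAbelianGroup_quot_restrict {S : Type u} [RightLoop S] {R : RightLoopCon S}
    {T : RightSubloop S} (h : ∀ x ∈ T, IsCentralElement (R.cls x)) :
    IsAbelianGroup (R.restrict T).Quot := by
  refine isAbelianGroup_iff.2 ⟨fun x y z => ?_, fun x y => ?_⟩
  · obtain ⟨x, rfl⟩ := (R.restrict T).cls_surjective x
    obtain ⟨y, rfl⟩ := (R.restrict T).cls_surjective y
    obtain ⟨z, rfl⟩ := (R.restrict T).cls_surjective z
    -- Two elements of `T` have the same class in the quotient of `T` exactly when they have the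
    -- same class in `S / R`, so the law is checked there.
    exact (R.restrict T).cls_eq_cls.2
      (R.cls_eq_cls.1 ((h x x.2).assoc (R.cls y) (R.cls z)))
  · obtain ⟨x, rfl⟩ := (R.restrict T).cls_surjective x
    obtain ⟨y, rfl⟩ := (R.restrict T).cls_surjective y
    exact (R.restrict T).cls_eq_cls.2 (R.cls_eq_cls.1 ((h x x.2).comm (R.cls y)))

end RightLoopCon

namespace RightLoop

/-- The center congruence is defined as a join; the point is that this join is itself central, so
its own centering congruence can be used. -/
theorem isCentralElement_of_mem_center {S : Type u} [RightLoop S] {z : S} (hz : z ∈ center S) :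
    IsCentralElement z :=
  (isGreatest_centerCon S).1.isCentralElement hz

/-- One step of the comparison: taking the derived subloop moves down at least one term of the upper
central series. -/
theorem ofSub_derived_subset_upperCentralSeries {S : Type u} [RightLoop S] {T : RightSubloop S}
    {i : ℕ} (hT : (T : Set S) ⊆ upperCentralSeries S (i + 1)) :
    (RightSubloop.ofSub (derived T) : Set S) ⊆ upperCentralSeries S i := by
  rintro _ ⟨x, hx, rfl⟩
  -- `hx` relates `x` to `1` under every congruence on `T` with abelian group quotient. By
  -- definition `hT hy` says that the class of `y` lies in the center of `S / Zᵢ`.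
  exact hx _ (RightLoopCon.isAbelianGroup_quot_restrict (R := upperCentralCon S i) fun y hy =>
    isCentralElement_of_mem_center (hT hy))

/-- Induction on `k`, with `i` free because it rises by one when `k` drops by one. Writing `k + i =
n` avoids truncated subtraction. -/
theorem derivedSeries_subset_upperCentralSeries {S : Type u} [RightLoop S] {n : ℕ}
    (hn : (upperCentralSeries S n : Set S) = Set.univ) :
    ∀ k i : ℕ, k + i = n → (derivedSeries S k : Set S) ⊆ upperCentralSeries S i
  | 0, i, h => by
    obtain rfl : i = n := by omega
    exact fun x _ => hn.symm ▸ Set.mem_univ x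
  | k + 1, i, h =>
    ofSub_derived_subset_upperCentralSeries
      (derivedSeries_subset_upperCentralSeries hn k (i + 1) (by omega))

end RightLoop

/-- Every nilpotent right loop is a solvable right loop. -/
theorem mainTheorem8 (S : Type*) [RightLoop S] (hS : RightLoop.IsNilpotent S) :
    RightLoop.IsSolvable S := by
  obtain ⟨n, hn⟩ := hS
  -- The same `n` serves for both series: the case `k = n`, `i = 0` lands in `Z₀`, which is `{1}` by
  -- definition.
  refine ⟨n, Set.Subset.antisymm
    (RightLoop.derivedSeries_subset_upperCentralSeries hn n 0 (Nat.add_zero n)) ?_⟩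
  rintro _ rfl
  exact (RightLoop.derivedSeries S n).one_mem'
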